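/- **Setting.** For a finite set $X$, a probability vector $\pi$ on $X$ and a subprobability matrix $T$ on $X$ (nonnegative entries, row sums at most one), consider the Markov chain on $X\cup\{\Delta\}$ with initial distribution $\pi$, transition probabilities $T$ inside $X$, jumping from $i\in X$ to the absorbing state $\Delta$ with probability $1-\sum_j T_{ij}$. If the chain is almost surely terminating (it almost surely reaches $\Delta$), the law of its termination time $\inf\{n\ge 1: \text{the chain is in }\Delta\text{ at time }n\}$ is denoted $\operatorname{DPH}(\pi,T)$; a random variable follows a DPH distribution if its law is of this form for some finite $X$ and some such $\pi,T$. Let $\mathcal E,\mathcal S$ be disjoint finite sets, $\boldsymbol\alpha$ a probability vector on $\mathcal E$, $\boldsymbol P$ (indexed by $\mathcal E\times\mathcal E$) and $\boldsymbol U$ (indexed by $\mathcal E\times\mathcal S$) nonnegative matrices such that each row of $(\boldsymbol P\ \boldsymbol U)$ sums to one, and $\boldsymbol Q_1,\boldsymbol Q_2$ subprobability matrices on $\mathcal S$. Let $(M_1,M_2)$ be the following process with coordinates in $\mathcal E\cup\mathcal S\cup\{\Delta\}$: $M_1(0)=M_2(0)$ has law $\boldsymbol\alpha$; while in $\mathcal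 E$, both coordinates move together, according to $(\boldsymbol P\ \boldsymbol U)$, so that they enter $\mathcal S$ at the same time and in the same state; from then on they evolve independently, $M_k$ moving within $\mathcal S$ according to $\boldsymbol Q_k$ and terminating (jumping to the absorbing state $\Delta$) from $i$ with probability $q_{k,i}=1-\sum_j (\boldsymbol Q_k)_{ij}$. Both $M_1$ and $M_2$ are assumed to be almost surely terminating. A random vector $(\tau_1,\tau_2)$ is $\operatorname{CDPH}(\boldsymbol\alpha,\boldsymbol P,\boldsymbol U,\boldsymbol Q_1,\boldsymbol Q_2)$ distributed if it has the joint law of the termination times of $M_1$ and $M_2$. Let $\gamma$ be the terminating Markov chain on $\mathcal E\cup(\mathcal S\times\mathcal S)\cup(\{\partial_1\}\times\mathcal S)\cup(\mathcal S\times\{\partial_2\})$ with initial vector $(\boldsymbol\alpha,\boldsymbol 0,\boldsymbol 0,\boldsymbol 0)$ and subprobability matrix $$\begin{pmatrix}\boldsymbol P&\boldsymbol U^*&\boldsymbol 0&\boldsymbol 0\\ \boldsymbol 0&\boldsymbol Q_1\otimes\boldsymbol Q_2&\boldsymbol q_1\otimes\boldsymbol Q_2&\boldsymbol Q_1\otimes\boldsymbol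 q_2\\ \boldsymbol 0&\boldsymbol 0&\boldsymbol Q_2&\boldsymbol 0\\ \boldsymbol 0&\boldsymbol 0&\boldsymbol 0&\boldsymbol Q_1\end{pmatrix},\qquad u^*_{i,(j_1,j_2)}=u_{ij_1}\delta_{j_1,j_2},$$ and let $\sigma$ be its termination time. **Proposition (Aggregation $\tau_1+\tau_2$).** Let $(\tau_1,\tau_2)$ be $\operatorname{CDPH}(\boldsymbol\alpha,\boldsymbol P,\boldsymbol U,\boldsymbol Q_1,\boldsymbol Q_2)$ distributed. Then $\tau_1+\tau_2$ follows a DPH distribution. Moreover, $\gamma$ almost surely terminates and $\tau_1+\tau_2$ has the same law as the integer reward accumulated along $\gamma$, $$\sum_{\ell=0}^{\sigma-1}\Bigl(2\cdot\mathbf 1_{\gamma(\ell)\in\mathcal E\cup(\mathcal S\times\mathcal S)}+\mathbf 1_{\gamma(\ell)\in(\{\partial_1\}\times\mathcal S)\cup(\mathcal S\times\{\partial_2\})}\Bigr).$$ -/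

import Mathlib

open MeasureTheory ProbabilityTheory

/-- The cemetery `none` is adjoined to a state space; state spaces are finite and carry the
discrete σ-algebra. -/
instance instMeasurableSpaceOptionDiscrete (X : Type*) : MeasurableSpace (Option X) := ⊤

/-- The law on path space of the time-homogeneous Markov chain with initial distribution `init`
and one-step transition probabilities `step x` out of the state `x`. -/
noncomputable def markovChainLaw {X : Type*} [MeasurableSpace X] [Countable X]
    [MeasurableSingletonClass X] (init : PMF X) (step : X → PMF X) : Measure (ℕ → X) :=
  haveI : IsMarkovKernel (Kernel.ofFunOfCountable fun x => (step x).toMeasure) :=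
    ⟨fun x => inferInstanceAs (IsProbabilityMeasure (step x).toMeasure)⟩
  Kernel.trajMeasure (X := fun _ => X) init.toMeasure fun n =>
    (Kernel.ofFunOfCountable fun x => (step x).toMeasure).comap
      (fun h : (Finset.Iic n → X) => h ⟨n, Finset.mem_Iic.2 le_rfl⟩) (measurable_pi_apply _)

/-- A subprobability vector on `X`, completed to a probability on `X ∪ {none}` by giving the
missing mass to the cemetery. -/
noncomputable def subPMF {X : Type*} [Fintype X] (v : X → ℝ) (h0 : ∀ i, 0 ≤ v i)
    (h1 : ∑ i, v i ≤ 1) : PMF (Option X) :=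
  PMF.ofFintype
    (fun o => match o with
      | none => ENNReal.ofReal (1 - ∑ i, v i)
      | some i => ENNReal.ofReal (v i))
    (by
      rw [Fintype.sum_option, ← ENNReal.ofReal_sum_of_nonneg fun i _ => h0 i,
        ← ENNReal.ofReal_add (by linarith) (Finset.sum_nonneg fun i _ => h0 i)]
      simp)

/-- The first positive time at which a path is in the cemetery (used only for processes that
almost surely terminate). -/
noncomputable def terminationTime {X : Type*} (x : ℕ → Option X) : ℕ :=
  sInf {n | 0 < n ∧ x n = none}

/-- A finite-state terminating-chain specification: an initial probability vector and a
subprobability matrix. -/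
structure SubMarkov (X : Type*) [Fintype X] where
  init : X → ℝ
  trans : Matrix X X ℝ
  init_nonneg : ∀ i, 0 ≤ init i
  init_sum : ∑ i, init i = 1
  trans_nonneg : ∀ i j, 0 ≤ trans i j
  trans_sum : ∀ i, ∑ j, trans i j ≤ 1

namespace SubMarkov

variable {X : Type*} [Fintype X]

/-- Initial distribution on the state space augmented by the absorbing cemetery. -/
noncomputable def initPMF (q : SubMarkov X) : PMF (Option X) :=
  subPMF q.init q.init_nonneg q.init_sum.le

/-- Transition probabilities on the state space augmented by the absorbing cemetery. -/
noncomputable def stepPMF (q : SubMarkov X) : Option X → PMF (Option X)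
  | none => PMF.pure none
  | some i => subPMF (q.trans i) (q.trans_nonneg i) (q.trans_sum i)

/-- The law of the Markov chain on path space. -/
noncomputable def chainLaw (q : SubMarkov X) : Measure (ℕ → Option X) :=
  markovChainLaw q.initPMF q.stepPMF

/-- The chain almost surely terminates. -/
def IsTerminating (q : SubMarkov X) : Prop :=
  ∀ᵐ x ∂q.chainLaw, ∃ n, 0 < n ∧ x n = none

/-- The law of the termination time of the chain, `DPH(init, trans)`. -/
noncomputable def dphLaw (q : SubMarkov X) : Measure ℕ :=
  q.chainLaw.map terminationTime

end SubMarkov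

/-- The random variable `Y` follows a discrete phase-type distribution. -/
def FollowsDPH {Ω : Type*} [MeasurableSpace Ω] (Y : Ω → ℕ) (μ : Measure Ω) : Prop :=
  ∃ (d : ℕ) (q : SubMarkov (Fin d)), q.IsTerminating ∧ HasLaw Y q.dphLaw μ

/-- The parameters `(α, P, U, Q₁, Q₂)` of a common-shock discrete phase-type distribution. -/
structure CDPHParam (E S : Type*) [Fintype E] [Fintype S] where
  α : E → ℝ
  P : Matrix E E ℝ
  U : Matrix E S ℝ
  Q₁ : Matrix S S ℝ
  Q₂ : Matrix S S ℝ
  α_nonneg : ∀ i, 0 ≤ α i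
  α_sum : ∑ i, α i = 1
  P_nonneg : ∀ i j, 0 ≤ P i j
  U_nonneg : ∀ i j, 0 ≤ U i j
  PU_sum : ∀ i, ∑ j, P i j + ∑ j, U i j = 1
  Q₁_nonneg : ∀ i j, 0 ≤ Q₁ i j
  Q₁_sum : ∀ i, ∑ j, Q₁ i j ≤ 1
  Q₂_nonneg : ∀ i j, 0 ≤ Q₂ i j
  Q₂_sum : ∀ i, ∑ j, Q₂ i j ≤ 1

namespace CDPHParam

variable {E S : Type*} [Fintype E] [Fintype S]

/-- The chain on `E ∪ S` with initial vector `(α, 0)` and block matrix `(P, U; 0, Q)`. -/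
def marginal (p : CDPHParam E S) (Q : Matrix S S ℝ) (hQ : ∀ i j, 0 ≤ Q i j)
    (hQ' : ∀ i, ∑ j, Q i j ≤ 1) : SubMarkov (E ⊕ S) where
  init := Sum.elim p.α 0
  trans := Matrix.fromBlocks p.P p.U 0 Q
  init_nonneg := by
    rintro (i | i)
    · exact p.α_nonneg i
    · exact le_rfl
  init_sum := by simp [p.α_sum]
  trans_nonneg := by
    rintro (i | i) (j | j)
    · exact p.P_nonneg i j
    · exact p.U_nonneg i j
    · exact le_rfl
    · exact hQ i j
  trans_sum := by
    rintro (i | i)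
    · simp [p.PU_sum i]
    · simpa using hQ' i

/-- Marginal specification of `M₁`. -/
def marginal₁ (p : CDPHParam E S) : SubMarkov (E ⊕ S) := p.marginal p.Q₁ p.Q₁_nonneg p.Q₁_sum

/-- Marginal specification of `M₂`. -/
def marginal₂ (p : CDPHParam E S) : SubMarkov (E ⊕ S) := p.marginal p.Q₂ p.Q₂_nonneg p.Q₂_sum

/-- `M₁` and `M₂` start in the same state. -/
noncomputable def pairInit (p : CDPHParam E S) : PMF (Option (E ⊕ S) × Option (E ⊕ S)) :=
  p.marginal₁.initPMF.map fun x => (x, x)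

/-- As long as the common state is in `E`, both coordinates make the same transition (so they
enter `S` together, in the same state); afterwards they move independently, `M₁` according to
`Q₁` and `M₂` according to `Q₂`. -/
noncomputable def pairStep (p : CDPHParam E S) :
    Option (E ⊕ S) × Option (E ⊕ S) → PMF (Option (E ⊕ S) × Option (E ⊕ S))
  | (some (Sum.inl i), _) => (p.marginal₁.stepPMF (some (Sum.inl i))).map fun x => (x, x)
  | (x, y) => (p.marginal₁.stepPMF x).bind fun x' => (p.marginal₂.stepPMF y).map fun y' => (x', y')

/-- The law of the joint process `(M₁, M₂)`. -/
noncomputable def pairLaw (p : CDPHParam E S) :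
    Measure (ℕ → Option (E ⊕ S) × Option (E ⊕ S)) :=
  markovChainLaw p.pairInit p.pairStep

/-- Both `M₁` and `M₂` almost surely terminate. -/
def IsTerminating (p : CDPHParam E S) : Prop :=
  ∀ᵐ x ∂p.pairLaw, (∃ n, 0 < n ∧ (x n).1 = none) ∧ (∃ n, 0 < n ∧ (x n).2 = none)

/-- The joint law of the termination times of `M₁` and `M₂`. -/
noncomputable def cdphLaw (p : CDPHParam E S) : Measure (ℕ × ℕ) :=
  p.pairLaw.map fun x =>
    (terminationTime fun n => (x n).1, terminationTime fun n => (x n).2)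

end CDPHParam

/-- The random vector `(τ₁, τ₂)` follows the distribution `CDPH(α, P, U, Q₁, Q₂)`, where the two
underlying processes are almost surely terminating. -/
def FollowsCDPH {E S Ω : Type*} [Fintype E] [Fintype S] [MeasurableSpace Ω] (p : CDPHParam E S)
    (τ₁ τ₂ : Ω → ℕ) (μ : Measure Ω) : Prop :=
  p.IsTerminating ∧ HasLaw (fun ω => (τ₁ ω, τ₂ ω)) p.cdphLaw μ

/-- The state space `E ∪ (S × S) ∪ ({∂₁} × S) ∪ (S × {∂₂})`, in this order. -/
abbrev GammaState (E S : Type*) : Type _ := E ⊕ (S × S) ⊕ S ⊕ S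

namespace CDPHParam

variable {E S : Type*} [Fintype E] [Fintype S] [DecidableEq S]

/-- The one-step termination probabilities `1 - Q 1`. -/
def exit (Q : Matrix S S ℝ) (i : S) : ℝ := 1 - ∑ j, Q i j

/-- The block matrix with rows `(P, U*, 0, 0)`, `(0, Q₁ ⊗ Q₂, q₁ ⊗ Q₂, Q₁ ⊗ q₂)`,
`(0, 0, Q₂, 0)`, `(0, 0, 0, Q₁)`, where `U*` sends `i` to `(j, j)` with probability `U i j`. -/
def gammaMatrix (p : CDPHParam E S) : Matrix (GammaState E S) (GammaState E S) ℝ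
  | .inl i, .inl j => p.P i j
  | .inl i, .inr (.inl (j₁, j₂)) => if j₁ = j₂ then p.U i j₁ else 0
  | .inr (.inl (i₁, i₂)), .inr (.inl (j₁, j₂)) => p.Q₁ i₁ j₁ * p.Q₂ i₂ j₂
  | .inr (.inl (i₁, i₂)), .inr (.inr (.inl j)) => exit p.Q₁ i₁ * p.Q₂ i₂ j
  | .inr (.inl (i₁, i₂)), .inr (.inr (.inr j)) => p.Q₁ i₁ j * exit p.Q₂ i₂
  | .inr (.inr (.inl i)), .inr (.inr (.inl j)) => p.Q₂ i j
  | .inr (.inr (.inr i)), .inr (.inr (.inr j)) => p.Q₁ i j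
  | _, _ => 0

/-- The chain `γ`: initial vector `(α, 0, 0, 0)` and transition matrix `gammaMatrix`. -/
def gamma (p : CDPHParam E S) : SubMarkov (GammaState E S) where
  init := Sum.elim p.α 0
  trans := p.gammaMatrix
  init_nonneg := by
    rintro (i | i)
    · exact p.α_nonneg i
    · exact le_rfl
  init_sum := by simp [p.α_sum]
  trans_nonneg := by
    have h₁ : ∀ i, 0 ≤ exit p.Q₁ i := fun i => sub_nonneg.2 (p.Q₁_sum i)
    have h₂ : ∀ i, 0 ≤ exit p.Q₂ i := fun i => sub_nonneg.2 (p.Q₂_sum i)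
    rintro (i | ⟨i₁, i₂⟩ | i | i) (j | ⟨j₁, j₂⟩ | j | j) <;> simp only [gammaMatrix, le_refl]
    · exact p.P_nonneg i j
    · split_ifs
      · exact p.U_nonneg i j₁
      · exact le_rfl
    · exact mul_nonneg (p.Q₁_nonneg _ _) (p.Q₂_nonneg _ _)
    · exact mul_nonneg (h₁ _) (p.Q₂_nonneg _ _)
    · exact mul_nonneg (p.Q₁_nonneg _ _) (h₂ _)
    · exact p.Q₂_nonneg _ _
    · exact p.Q₁_nonneg _ _
  trans_sum := by
    rintro (i | ⟨i₁, i₂⟩ | i | i)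
    · simp [gammaMatrix, Fintype.sum_sum_type, Fintype.sum_prod_type, p.PU_sum i]
    · simp only [gammaMatrix, exit, Fintype.sum_sum_type, Fintype.sum_prod_type,
        ← Finset.mul_sum, ← Finset.sum_mul, Finset.sum_const_zero]
      nlinarith [mul_nonneg (sub_nonneg.2 (p.Q₁_sum i₁)) (sub_nonneg.2 (p.Q₂_sum i₂))]
    · simpa [gammaMatrix, Fintype.sum_sum_type] using p.Q₂_sum i
    · simpa [gammaMatrix, Fintype.sum_sum_type] using p.Q₁_sum i

end CDPHParam

/-- Reward `2` on `E ∪ (S × S)` and reward `1` on `({∂₁} × S) ∪ (S × {∂₂})`; no reward after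
termination. -/
def aggregationReward {E S : Type*} : Option (GammaState E S) → ℕ
  | some (.inl _) => 2
  | some (.inr (.inl _)) => 2
  | some (.inr (.inr _)) => 1
  | none => 0

/-- The total reward accumulated along a path before termination. -/
noncomputable def accumulatedReward {E S : Type*} (x : ℕ → Option (GammaState E S)) : ℕ :=
  ∑ l ∈ Finset.range (terminationTime x), aggregationReward (x l)

/-! The map `gammaPair` records the states of both coordinates at a state of `γ`, with `∂₁` and `∂₂`
both read as the cemetery. It is injective and intertwines the one-step transitions
(`map_gamma_stepPMF`), so `(M₁, M₂)` has the law of the image of `γ` (`pairLaw_eq_map`). The reward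
of a state of `γ` is the number of coordinates still alive there. A coordinate starts alive and
never leaves the cemetery, so its time alive is its termination time; summing along the path gives
`τ₁ + τ₂` (`accumulatedReward_ae`).

For the phase-type property, reward is turned into time: in `SubMarkov.expand`, a state of reward 2
must be left through a second copy of itself. No coupling of the two chains is built. Instead
`rewardProb_expand` compares the probabilities that the total reward equals `n`, by strong induction
on `n` and first-step analysis. Total rewards live in `ENNReal`, where non-termination shows up as
the value `⊤`. Since the finite values carry all the mass for `γ`, they do so for the expanded
chain, which therefore terminates (`followsDPH_of_totalReward`). -/

/-! ### Path laws of Markov chains -/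

section MarkovChain

variable {X : Type*} [MeasurableSpace X] [Countable X] [MeasurableSingletonClass X]

instance isProbabilityMeasure_markovChainLaw (init : PMF X) (step : X → PMF X) :
    IsProbabilityMeasure (markovChainLaw init step) := by
  unfold markovChainLaw
  infer_instance

/-- The paths that agree with `a` up to time `n`. -/
def pathCylinder {X : Type*} (n : ℕ) (a : ℕ → X) : Set (ℕ → X) := {x | ∀ i ≤ n, x i = a i}

lemma pathCylinder_eq_preimage {X : Type*} (n : ℕ) (a : ℕ → X) :
    pathCylinder n a = Preorder.frestrictLe (π := fun _ => X) n ⁻¹'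
      {Preorder.frestrictLe (π := fun _ => X) n a} := by
  ext x
  simp [pathCylinder, funext_iff]

lemma measurableSet_pathCylinder {X : Type*} [MeasurableSpace X] [MeasurableSingletonClass X]
    (n : ℕ) (a : ℕ → X) : MeasurableSet (pathCylinder n a) := by
  rw [pathCylinder_eq_preimage]
  exact Preorder.measurable_frestrictLe n (measurableSet_singleton _)

/-- Finite measures on path space are determined by the cylinders. -/
lemma measure_ext_of_pathCylinder {μ ν : Measure (ℕ → X)} [IsFiniteMeasure μ]
    [IsFiniteMeasure ν] (h : ∀ n a, μ (pathCylinder n a) = ν (pathCylinder n a)) : μ = ν := by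
  have key : ∀ n, μ.map (Preorder.frestrictLe (π := fun _ => X) n) =
      ν.map (Preorder.frestrictLe (π := fun _ => X) n) := by
    intro n
    refine Measure.ext_of_singleton fun b => ?_
    obtain ⟨a, rfl⟩ : ∃ a, Preorder.frestrictLe (π := fun _ => X) n a = b :=
      -- A finite history is prolonged by its last state; the values after `n` are irrelevant.
      ⟨fun i => if hi : i ≤ n then b ⟨i, Finset.mem_Iic.2 hi⟩ else b ⟨n, by simp⟩, by
        ext ⟨i, hi⟩
        simp [Finset.mem_Iic.1 hi]⟩
    rw [Measure.map_apply (by fun_prop) (measurableSet_singleton _),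
      Measure.map_apply (by fun_prop) (measurableSet_singleton _), ← pathCylinder_eq_preimage, h]
  -- Every finite set of times lies in an initial segment, so `key` makes both measures projective
  -- limits of one family, and such a limit is unique.
  have hμ : IsProjectiveLimit μ fun I : Finset ℕ => ν.map I.restrict := by
    intro I
    simp only
    rw [← Finset.restrict₂_comp_restrict I.subset_Iic_sup_id,
      ← Measure.map_map (by fun_prop) (by fun_prop)]
    rw [← Measure.map_map (by fun_prop) (by fun_prop)]
    exact congrArg _ (key _)
  have hν : IsProjectiveLimit ν fun I : Finset ℕ => ν.map I.restrict := fun I => rfl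
  exact hμ.unique hν

lemma markovChainLaw_zero (init : PMF X) (step : X → PMF X) (a : X) :
    markovChainLaw init step {x | x 0 = a} = init a := by
  have h : {x : ℕ → X | x 0 = a} = Preorder.frestrictLe (π := fun _ => X) 0 ⁻¹'
      {fun _ => a} := by
    ext x
    simp [funext_iff]
  rw [h, ← Measure.map_apply (by fun_prop) (measurableSet_singleton _)]
  have : IsMarkovKernel (Kernel.ofFunOfCountable fun x => (step x).toMeasure) :=
    ⟨fun x => inferInstanceAs (IsProbabilityMeasure (step x).toMeasure)⟩
  unfold markovChainLaw Kernel.trajMeasure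
  rw [Measure.map_comp _ _ (by fun_prop), Kernel.traj_map_frestrictLe, Kernel.partialTraj_self,
    Measure.id_comp, Measure.map_apply (by fun_prop) (measurableSet_singleton _)]
  have h' : (MeasurableEquiv.piUnique fun _ : Finset.Iic 0 => X).symm ⁻¹' {fun _ => a} = {a} := by
    ext x
    simp [funext_iff, MeasurableEquiv.piUnique]
  exact (congrArg _ h').trans (PMF.toMeasure_apply_singleton _ _ (measurableSet_singleton _))

/-- The joint law of the history up to `n` and the next state is the composition product of the
history law with the step kernel; here it is evaluated on a product of singletons. -/
lemma markovChainLaw_succ (init : PMF X) (step : X → PMF X) (n : ℕ) (a : ℕ → X) :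
    markovChainLaw init step (pathCylinder (n + 1) a) =
      markovChainLaw init step (pathCylinder n a) * step (a n) (a (n + 1)) := by
  have h : pathCylinder (n + 1) a =
      (fun x : ℕ → X => (Preorder.frestrictLe (π := fun _ => X) n x, x (n + 1))) ⁻¹'
        ({Preorder.frestrictLe (π := fun _ => X) n a} ×ˢ {a (n + 1)}) := by
    ext x
    have hx : Preorder.frestrictLe (π := fun _ => X) n x =
        Preorder.frestrictLe (π := fun _ => X) n a ↔ x ∈ pathCylinder n a := by
      rw [pathCylinder_eq_preimage]
      rfl
    simp only [Set.mem_preimage, Set.mem_prod, Set.mem_singleton_iff, hx]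
    simp only [pathCylinder, Set.mem_ofPred_eq, Nat.le_succ_iff, or_imp, forall_and,
      forall_eq]
  rw [h, ← Measure.map_apply (by fun_prop)
    ((measurableSet_singleton _).prod (measurableSet_singleton _))]
  have : IsMarkovKernel (Kernel.ofFunOfCountable fun x => (step x).toMeasure) :=
    ⟨fun x => inferInstanceAs (IsProbabilityMeasure (step x).toMeasure)⟩
  unfold markovChainLaw
  rw [← Kernel.map_frestrictLe_trajMeasure_compProd_eq_map_trajMeasure,
    Measure.compProd_apply_prod (measurableSet_singleton _) (measurableSet_singleton _),
    lintegral_singleton, Measure.map_apply (by fun_prop) (measurableSet_singleton _),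
    ← pathCylinder_eq_preimage, mul_comm]
  congr 1
  exact PMF.toMeasure_apply_singleton _ _ (measurableSet_singleton _)

/-- The probability that the chain follows a given finite path. -/
lemma markovChainLaw_pathCylinder (init : PMF X) (step : X → PMF X) (n : ℕ) (a : ℕ → X) :
    markovChainLaw init step (pathCylinder n a) =
      init (a 0) * ∏ i ∈ Finset.range n, step (a i) (a (i + 1)) := by
  induction n with
  | zero => simpa [pathCylinder] using markovChainLaw_zero init step (a 0)
  | succ n ih => rw [markovChainLaw_succ, ih, Finset.prod_range_succ, mul_assoc]

/-- Almost every path uses only transitions of positive probability. -/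
lemma markovChainLaw_ae_step (init : PMF X) (step : X → PMF X) :
    ∀ᵐ x ∂markovChainLaw init step, init (x 0) ≠ 0 ∧ ∀ n, step (x n) (x (n + 1)) ≠ 0 := by
  have key : ∀ n, ∀ᵐ x ∂markovChainLaw init step,
      init (x 0) * ∏ i ∈ Finset.range n, step (x i) (x (i + 1)) ≠ 0 := by
    intro n
    rw [ae_iff]
    -- There are only countably many histories up to `n`, so those of probability zero form a null
    -- set together.
    refine measure_mono_null (t := ⋃ b ∈ {b : Finset.Iic n → X | markovChainLaw init step
        (Preorder.frestrictLe (π := fun _ => X) n ⁻¹' {b}) = 0},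
        Preorder.frestrictLe (π := fun _ => X) n ⁻¹' {b}) ?_ ?_
    · intro x hx
      simp only [ne_eq, not_not, Set.mem_ofPred_eq] at hx
      rw [← markovChainLaw_pathCylinder, pathCylinder_eq_preimage] at hx
      exact Set.mem_biUnion (x := Preorder.frestrictLe (π := fun _ => X) n x) hx rfl
    · exact (measure_biUnion_null_iff (Set.to_countable _)).2 fun b hb => hb
  filter_upwards [ae_all_iff.2 key] with x hx
  refine ⟨by simpa using hx 0, fun n h => hx (n + 1) ?_⟩
  rw [Finset.prod_range_succ, h, mul_zero, mul_zero]

/-- The image of a Markov chain under an injection that intertwines the transitions. -/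
lemma map_markovChainLaw {Y : Type*} [MeasurableSpace Y] [Countable Y]
    [MeasurableSingletonClass Y] {ψ : X → Y} (hψ : Function.Injective ψ)
    (init : PMF X) (step : X → PMF X) (init' : PMF Y) (step' : Y → PMF Y)
    (hinit : init.map ψ = init') (hstep : ∀ x, (step x).map ψ = step' (ψ x)) :
    (markovChainLaw init step).map (fun x n => ψ (x n)) = markovChainLaw init' step' := by
  have hm : Measurable fun (x : ℕ → X) n => ψ (x n) :=
    measurable_pi_lambda _ fun n => (measurable_of_countable ψ).comp (measurable_pi_apply n)
  have hmap : ∀ (q : PMF X) (x : X), q.map ψ (ψ x) = q x := by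
    intro q x
    rw [PMF.map_apply, tsum_eq_single x]
    · simp
    · intro b hb
      simp [hψ.ne hb.symm]
  have hmap0 : ∀ (q : PMF X) (y : Y), (∀ x, ψ x ≠ y) → q.map ψ y = 0 := by
    intro q y hy
    rw [PMF.map_apply]
    simp [fun x => (hy x).symm]
  have : IsProbabilityMeasure ((markovChainLaw init step).map fun x n => ψ (x n)) :=
    Measure.isProbabilityMeasure_map hm.aemeasurable
  refine measure_ext_of_pathCylinder fun n b => ?_
  rw [Measure.map_apply hm (measurableSet_pathCylinder n b)]
  induction n with
  | zero =>
    by_cases hb : ∃ a, ψ a = b 0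
    · obtain ⟨a, ha⟩ := hb
      have : (fun (x : ℕ → X) n => ψ (x n)) ⁻¹' pathCylinder 0 b = pathCylinder 0 fun _ => a := by
        ext x
        simp [pathCylinder, ← ha, hψ.eq_iff]
      rw [this, markovChainLaw_pathCylinder, markovChainLaw_pathCylinder, ← ha, ← hinit, hmap]
      simp
    · push Not at hb
      have : (fun (x : ℕ → X) n => ψ (x n)) ⁻¹' pathCylinder 0 b = ∅ := by
        ext x
        simp [pathCylinder, hb]
      rw [this, markovChainLaw_pathCylinder, ← hinit, hmap0 _ _ hb]
      simp
  | succ n ih =>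
    rw [markovChainLaw_succ, ← ih]
    -- If `b` leaves the range of `ψ` before time `n + 1`, both preimages are empty. Otherwise
    -- injectivity makes the preimage of the cylinder a single cylinder.
    by_cases hne : ∃ x : ℕ → X, ∀ i ≤ n, ψ (x i) = b i
    · obtain ⟨a, ha⟩ := hne
      have hn : (fun (x : ℕ → X) n => ψ (x n)) ⁻¹' pathCylinder n b = pathCylinder n a := by
        ext x
        exact forall₂_congr fun i hi => by simp only [← ha i hi, hψ.eq_iff]
      rw [hn]
      by_cases hb : ∃ c, ψ c = b (n + 1)
      · obtain ⟨c, hc⟩ := hb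
        have hn1 : (fun (x : ℕ → X) n => ψ (x n)) ⁻¹' pathCylinder (n + 1) b =
            pathCylinder (n + 1) fun i => if i ≤ n then a i else c := by
          ext x
          refine forall₂_congr fun i hi => ?_
          rcases Nat.le_succ_iff.1 hi with h | rfl
          · simp only [← ha i h, hψ.eq_iff, h, if_true]
          · simp [← hc, hψ.eq_iff]
        have hn2 : (pathCylinder n fun i => if i ≤ n then a i else c) = pathCylinder n a := by
          ext x
          exact forall₂_congr fun i hi => by simp [hi]
        rw [hn1, markovChainLaw_succ, hn2, ← ha n le_rfl, ← hc, ← hstep, hmap]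
        simp
      · push Not at hb
        have hn1 : (fun (x : ℕ → X) n => ψ (x n)) ⁻¹' pathCylinder (n + 1) b = ∅ :=
          Set.eq_empty_of_forall_notMem fun x hx => hb _ (hx (n + 1) le_rfl)
        rw [hn1, ← ha n le_rfl, ← hstep, hmap0 _ _ hb]
        simp
    · have hn : (fun (x : ℕ → X) n => ψ (x n)) ⁻¹' pathCylinder n b = ∅ :=
        Set.eq_empty_of_forall_notMem fun x hx => hne ⟨x, hx⟩
      have hn1 : (fun (x : ℕ → X) n => ψ (x n)) ⁻¹' pathCylinder (n + 1) b = ∅ :=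
        Set.eq_empty_of_forall_notMem fun x hx => hne ⟨x, fun i hi => hx i (by omega)⟩
      rw [hn, hn1]
      simp

/-- The path `x` preceded by the state `o`. -/
def consPath {X : Type*} (o : X) (x : ℕ → X) : ℕ → X
  | 0 => o
  | n + 1 => x n

lemma measurable_consPath {X : Type*} [MeasurableSpace X] (o : X) : Measurable (consPath o) := by
  refine measurable_pi_lambda _ fun n => ?_
  cases n with
  | zero => exact measurable_const
  | succ n => exact measurable_pi_apply n

/-- First-step decomposition of a Markov chain. -/
lemma markovChainLaw_eq_sum (init : PMF X) (step : X → PMF X) :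
    markovChainLaw init step =
      Measure.sum fun o => init o • (markovChainLaw (step o) step).map (consPath o) := by
  have hcyl : ∀ n a, Measure.sum (fun o => init o •
      (markovChainLaw (step o) step).map (consPath o)) (pathCylinder n a) =
      init (a 0) * ∏ i ∈ Finset.range n, step (a i) (a (i + 1)) := by
    intro n a
    -- A path of the form `consPath o x` starts at `o`, so only the term `o = a 0` meets the
    -- cylinder.
    rw [Measure.sum_apply _ (measurableSet_pathCylinder n a), tsum_eq_single (a 0)]
    · rw [Measure.smul_apply, Measure.map_apply (measurable_consPath _)
        (measurableSet_pathCylinder n a), smul_eq_mul]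
      congr 1
      cases n with
      | zero =>
        have : consPath (a 0) ⁻¹' pathCylinder 0 a = Set.univ := by
          ext x
          simp [pathCylinder, consPath]
        simp [this]
      | succ n =>
        have : consPath (a 0) ⁻¹' pathCylinder (n + 1) a = pathCylinder n fun i => a (i + 1) := by
          ext x
          refine ⟨fun h i hi => h (i + 1) (by omega), fun h i hi => ?_⟩
          cases i with
          | zero => rfl
          | succ i => exact h i (by omega)
        rw [this, markovChainLaw_pathCylinder, Finset.prod_range_succ', mul_comm]
    · intro o ho
      have : consPath o ⁻¹' pathCylinder n a = ∅ :=
        Set.eq_empty_of_forall_notMem fun x hx => ho (hx 0 (Nat.zero_le n))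
      rw [Measure.smul_apply, Measure.map_apply (measurable_consPath _)
        (measurableSet_pathCylinder n a), this]
      simp
  have : IsFiniteMeasure (Measure.sum fun o => init o •
      (markovChainLaw (step o) step).map (consPath o)) := by
    refine ⟨?_⟩
    rw [Measure.sum_apply _ MeasurableSet.univ]
    simp [Measure.map_apply (measurable_consPath _) MeasurableSet.univ, init.tsum_coe]
  refine measure_ext_of_pathCylinder fun n a => ?_
  rw [hcyl, markovChainLaw_pathCylinder]

lemma markovChainLaw_apply_eq_tsum (init : PMF X) (step : X → PMF X) {A : Set (ℕ → X)}
    (hA : MeasurableSet A) :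
    markovChainLaw init step A =
      ∑' o, init o * markovChainLaw (step o) step (consPath o ⁻¹' A) := by
  rw [markovChainLaw_eq_sum, Measure.sum_apply _ hA]
  simp [Measure.map_apply (measurable_consPath _) hA]

end MarkovChain

/-! ### First-step analysis of the total reward -/

section Reward

/-- The total reward collected along an infinite path, each visit of `y` being worth `ρ y`. -/
noncomputable def totalReward {Y : Type*} (ρ : Y → ℕ) (x : ℕ → Y) : ENNReal :=
  ∑' l, (ρ (x l) : ENNReal)

lemma totalReward_consPath {Y : Type*} (ρ : Y → ℕ) (o : Y) (x : ℕ → Y) :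
    totalReward ρ (consPath o x) = ρ o + totalReward ρ x := by
  unfold totalReward
  rw [tsum_eq_zero_add' ENNReal.summable]
  rfl

variable {Y : Type*} [MeasurableSpace Y] [Countable Y] [MeasurableSingletonClass Y]

lemma measurable_totalReward (ρ : Y → ℕ) : Measurable (totalReward ρ) := by
  refine Measurable.tsum fun l => ?_
  exact (measurable_of_countable fun y => (ρ y : ENNReal)).comp (measurable_pi_apply l)

/-- The probability that a chain started from `o` collects the total reward `n`. -/
noncomputable def rewardProb (step : Y → PMF Y) (ρ : Y → ℕ) (o : Y) (n : ℕ) : ENNReal :=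
  markovChainLaw (step o) step {x | ρ o + totalReward ρ x = n}

lemma markovChainLaw_totalReward_eq (init : PMF Y) (step : Y → PMF Y) (ρ : Y → ℕ) (n : ℕ) :
    markovChainLaw init step {x | totalReward ρ x = n} =
      ∑' o, init o * rewardProb step ρ o n := by
  have h : MeasurableSet {x | totalReward ρ x = n} :=
    measurable_totalReward ρ (measurableSet_singleton (n : ENNReal))
  rw [markovChainLaw_apply_eq_tsum _ _ h]
  simp only [Set.preimage_ofPred_eq, totalReward_consPath, rewardProb]

lemma rewardProb_of_lt (step : Y → PMF Y) (ρ : Y → ℕ) {o : Y} {n : ℕ} (h : n < ρ o) :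
    rewardProb step ρ o n = 0 := by
  have : {x | ρ o + totalReward ρ x = n} = ∅ := by
    refine Set.eq_empty_of_forall_notMem fun x (hx : _ = _) => ?_
    have h1 : (ρ o : ENNReal) ≤ n := hx ▸ le_self_add
    exact absurd (Nat.cast_le.1 h1) (not_le.2 h)
  rw [rewardProb, this, measure_empty]

/-- The finite reward of the starting state cancels, and the first step splits what remains. When `ρ
o` is positive the target drops strictly, which is what drives the later induction. -/
lemma rewardProb_add (step : Y → PMF Y) (ρ : Y → ℕ) (o : Y) (n : ℕ) :
    rewardProb step ρ o (ρ o + n) = ∑' o', step o o' * rewardProb step ρ o' n := by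
  have : {x | ρ o + totalReward ρ x = (ρ o + n : ℕ)} = {x | totalReward ρ x = n} := by
    ext x
    simp only [Set.mem_ofPred_eq, Nat.cast_add]
    exact ENNReal.add_right_inj (ENNReal.natCast_ne_top _)
  rw [rewardProb, this, markovChainLaw_totalReward_eq]

lemma rewardProb_of_absorbing {step : Y → PMF Y} {ρ : Y → ℕ} {o : Y} (ho : step o = PMF.pure o)
    (hρ : ρ o = 0) (n : ℕ) : rewardProb step ρ o n = if n = 0 then 1 else 0 := by
  have hae : ∀ᵐ x ∂markovChainLaw (step o) step, ρ o + totalReward ρ x = 0 := by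
    filter_upwards [markovChainLaw_ae_step (step o) step] with x hx
    have h : ∀ l, x l = o := by
      intro l
      induction l with
      | zero => simpa [ho] using hx.1
      | succ l ih => simpa [ih, ho] using hx.2 l
    simp [totalReward, h, hρ]
  rw [rewardProb]
  split_ifs with hn
  · rw [← prob_compl_eq_zero_iff₀, ← mem_ae_iff]
    · filter_upwards [hae] with x hx
      simpa [hn] using hx
    · exact (measurableSet_eq_fun ((measurable_totalReward ρ).const_add _)
        measurable_const).nullMeasurableSet
  · rw [measure_eq_zero_iff_ae_notMem]
    filter_upwards [hae] with x hx
    simpa [hx] using fun h => hn (by exact_mod_cast h.symm)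

end Reward

/-! ### Absorption and the termination time -/

section Absorbing

variable {X : Type*}

lemma eq_none_of_le {x : ℕ → Option X} (habs : ∀ n, x n = none → x (n + 1) = none) {m n : ℕ}
    (hm : x m = none) (hmn : m ≤ n) : x n = none :=
  Nat.le_induction hm (fun k _ => habs k) n hmn

lemma terminationTime_spec {x : ℕ → Option X} (h : ∃ n, 0 < n ∧ x n = none) :
    x (terminationTime x) = none :=
  (Nat.sInf_mem (s := {n | 0 < n ∧ x n = none}) h).2

lemma ne_none_of_lt_terminationTime {x : ℕ → Option X} (h0 : x 0 ≠ none) {n : ℕ}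
    (hn : n < terminationTime x) : x n ≠ none := by
  rcases Nat.eq_zero_or_pos n with rfl | hpos
  · exact h0
  · exact fun h => Nat.notMem_of_lt_sInf hn ⟨hpos, h⟩

/-- The reward which counts the time spent before termination. -/
def aliveReward (o : Option X) : ℕ := o.elim 0 fun _ => 1

lemma totalReward_eq_sum {x : ℕ → Option X} (habs : ∀ n, x n = none → x (n + 1) = none)
    (h : ∃ n, 0 < n ∧ x n = none) {ρ : Option X → ℕ} (hρ : ρ none = 0) :
    totalReward ρ x = (∑ l ∈ Finset.range (terminationTime x), ρ (x l) : ℕ) := by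
  rw [totalReward, tsum_eq_sum (s := Finset.range (terminationTime x)), Nat.cast_sum]
  intro l hl
  rw [eq_none_of_le habs (terminationTime_spec h) (by simpa using hl), hρ, Nat.cast_zero]

lemma totalReward_aliveReward {x : ℕ → Option X} (h0 : x 0 ≠ none)
    (habs : ∀ n, x n = none → x (n + 1) = none) (h : ∃ n, 0 < n ∧ x n = none) :
    totalReward aliveReward x = terminationTime x := by
  rw [totalReward_eq_sum habs h rfl, Finset.sum_congr rfl (g := fun _ => 1), Finset.sum_const,
    Finset.card_range, smul_eq_mul, mul_one]
  intro l hl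
  obtain ⟨i, hi⟩ := Option.ne_none_iff_exists'.1
    (ne_none_of_lt_terminationTime h0 (Finset.mem_range.1 hl))
  rw [hi]
  rfl

/-- A path that never terminates earns 1 at every time, hence infinite total reward. -/
lemma exists_eq_none_of_totalReward_ne_top {x : ℕ → Option X} (h0 : x 0 ≠ none)
    (h : totalReward aliveReward x ≠ ⊤) : ∃ n, 0 < n ∧ x n = none := by
  by_contra! hx
  refine h ?_
  have : ∀ l, (aliveReward (x l) : ENNReal) = 1 := by
    intro l
    obtain ⟨i, hi⟩ := Option.ne_none_iff_exists'.1
      (show x l ≠ none from (Nat.eq_zero_or_pos l).elim (fun e => e ▸ h0) (hx l))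
    rw [hi]
    exact Nat.cast_one
  simp only [totalReward, this]
  exact ENNReal.tsum_const_eq_top_of_ne_zero one_ne_zero

lemma measurable_terminationTime :
    Measurable (terminationTime : (ℕ → Option X) → ℕ) := by
  have hnone : ∀ k, MeasurableSet {x : ℕ → Option X | x k = none} := fun k =>
    measurable_pi_apply (X := fun _ : ℕ => Option X) k (measurableSet_singleton none)
  refine measurable_to_countable' fun n => ?_
  rcases Nat.eq_zero_or_pos n with rfl | hn
  -- The value 0 is the default `sInf ∅`, so it singles out the paths that never terminate.
  · have : terminationTime ⁻¹' {0} = ⋂ k : ℕ, {x : ℕ → Option X | x (k + 1) = none}ᶜ := by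
      ext x
      simp only [terminationTime, Set.mem_preimage, Set.mem_singleton_iff, Nat.sInf_eq_zero,
        Set.mem_iInter, Set.mem_compl_iff, Set.mem_ofPred_eq, lt_irrefl, false_and, false_or,
        Set.eq_empty_iff_forall_notMem, not_and]
      exact ⟨fun h k => h _ k.succ_pos, fun h k hk => Nat.succ_pred_eq_of_pos hk ▸ h (k - 1)⟩
    rw [this]
    exact MeasurableSet.iInter fun k => (hnone _).compl
  · have : terminationTime ⁻¹' {n} = {x : ℕ → Option X | x n = none} ∩
        ⋂ k : Fin n, ⋂ _ : 0 < k.1, {x : ℕ → Option X | x k = none}ᶜ := by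
      ext x
      simp only [Set.mem_preimage, Set.mem_singleton_iff, Set.mem_inter_iff, Set.mem_iInter,
        Set.mem_compl_iff, Set.mem_ofPred_eq]
      constructor
      · rintro rfl
        refine ⟨(Nat.sInf_mem (Nat.nonempty_of_pos_sInf hn)).2, fun k hk h => ?_⟩
        exact Nat.notMem_of_lt_sInf k.2 ⟨hk, h⟩
      · rintro ⟨h, h'⟩
        refine le_antisymm (Nat.sInf_le ⟨hn, h⟩) (le_of_not_gt fun hlt => ?_)
        obtain ⟨hpos, hm⟩ := Nat.sInf_mem (s := {n | 0 < n ∧ x n = none}) ⟨n, hn, h⟩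
        exact h' ⟨_, hlt⟩ hpos hm
    rw [this]
    exact (hnone n).inter (MeasurableSet.iInter fun k => MeasurableSet.iInter fun _ =>
      (hnone k).compl)

end Absorbing

/-! ### Converting reward into time by duplicating states -/

namespace SubMarkov

variable {X : Type*} [Fintype X]

lemma stepPMF_some_some (q : SubMarkov X) (i j : X) :
    q.stepPMF (some i) (some j) = ENNReal.ofReal (q.trans i j) := rfl

lemma stepPMF_some_none (q : SubMarkov X) (i : X) :
    q.stepPMF (some i) none = ENNReal.ofReal (1 - ∑ j, q.trans i j) := rfl

lemma stepPMF_none (q : SubMarkov X) : q.stepPMF none = PMF.pure none := rfl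

lemma initPMF_some (q : SubMarkov X) (i : X) :
    q.initPMF (some i) = ENNReal.ofReal (q.init i) := rfl

lemma initPMF_none (q : SubMarkov X) : q.initPMF none = 0 := by
  change ENNReal.ofReal (1 - ∑ i, q.init i) = 0
  simp [q.init_sum]

lemma chainLaw_ae (q : SubMarkov X) :
    ∀ᵐ x ∂q.chainLaw, x 0 ≠ none ∧ ∀ n, x n = none → x (n + 1) = none := by
  filter_upwards [markovChainLaw_ae_step q.initPMF q.stepPMF] with x hx
  refine ⟨fun h => hx.1 (h ▸ q.initPMF_none), fun n hn => ?_⟩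
  have := hx.2 n
  rw [hn] at this
  simpa [stepPMF] using this

open Classical in
/-- The transition matrix of `SubMarkov.expand`. -/
noncomputable def expandMatrix (T : Matrix X X ℝ) (b : X → Prop) : Matrix (X ⊕ X) (X ⊕ X) ℝ
  | .inl i, .inl j => if b i then 0 else T i j
  | .inl i, .inr j => if b i then (if i = j then 1 else 0) else 0
  | .inr i, .inl j => T i j
  | .inr _, .inr _ => 0

/-- The chain that spends `2` time units, instead of one, in each visit of a state of `q` for which
`b` holds: such a state is left through its second copy. -/
noncomputable def expand (q : SubMarkov X) (b : X → Prop) : SubMarkov (X ⊕ X) where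
  init := Sum.elim q.init 0
  trans := expandMatrix q.trans b
  init_nonneg := by
    rintro (i | i)
    · exact q.init_nonneg i
    · exact le_rfl
  init_sum := by simp [q.init_sum]
  trans_nonneg := by
    rintro (i | i) (j | j) <;> simp only [expandMatrix, le_refl]
    · split_ifs
      exacts [le_rfl, q.trans_nonneg i j]
    · split_ifs
      exacts [zero_le_one, le_rfl, le_rfl]
    · exact q.trans_nonneg i j
  trans_sum := by
    classical
    rintro (i | i)
    · by_cases h : b i <;> simp [expandMatrix, h, q.trans_sum i]
    · simpa [expandMatrix] using q.trans_sum i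

open Classical in
/-- Reward `2` in the states for which `b` holds, reward `1` in the other ones. -/
noncomputable def doubleReward (b : X → Prop) (o : Option X) : ℕ :=
  o.elim 0 fun i => if b i then 2 else 1

/-- The second copy of `i`, and the first copy when `b i` fails, both move by row `i` of `q`,
landing in first copies or in the cemetery. -/
lemma sum_expand_stepPMF {q : SubMarkov X} {b : X → Prop} {y : X ⊕ X} {i : X}
    (hy : y = .inr i ∨ y = .inl i ∧ ¬ b i) (f : Option (X ⊕ X) → ENNReal) (g : Option X → ENNReal)
    (h0 : f none = g none) (hs : ∀ j, f (some (.inl j)) = g (some j)) :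
    ∑ o, (q.expand b).stepPMF (some y) o * f o = ∑ o, q.stepPMF (some i) o * g o := by
  simp only [Fintype.sum_option, Fintype.sum_sum_type, stepPMF_some_some, stepPMF_some_none, h0,
    hs]
  rcases hy with rfl | ⟨rfl, hb⟩
  · simp [expand, expandMatrix]
  · simp [expand, expandMatrix, hb]

lemma rewardProb_expand (q : SubMarkov X) (b : X → Prop) (n : ℕ) (i : X) :
    rewardProb (q.expand b).stepPMF aliveReward (some (.inl i)) n =
      rewardProb q.stepPMF (doubleReward b) (some i) n := by
  induction n using Nat.strong_induction_on generalizing i with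
  | _ n ih =>
  -- From a copy that follows row `i` of `q`, one unit of time is spent and the induction hypothesis
  -- applies to every successor, with the smaller target `m`.
  have hleave : ∀ m < n, ∀ y, (y = .inr i ∨ y = .inl i ∧ ¬ b i) →
      rewardProb (q.expand b).stepPMF aliveReward (some y) (1 + m) =
        ∑' o', q.stepPMF (some i) o' * rewardProb q.stepPMF (doubleReward b) o' m := by
    intro m hm y hy
    rw [show 1 + m = aliveReward (some y) + m from rfl, rewardProb_add, tsum_fintype, tsum_fintype]
    refine sum_expand_stepPMF hy _ _ ?_ fun j => ih m hm j
    rw [rewardProb_of_absorbing (step := (q.expand b).stepPMF) rfl rfl,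
      rewardProb_of_absorbing (step := q.stepPMF) rfl rfl]
  by_cases hb : b i
  · have hr : doubleReward b (some i) = 2 := by simp [doubleReward, hb]
    rcases Nat.eq_zero_or_pos n with rfl | hn
    · rw [rewardProb_of_lt _ _ (show 0 < aliveReward (some _) from Nat.zero_lt_one), rewardProb_of_lt _ _ (by rw [hr]; omega)]
    obtain ⟨m, rfl⟩ := Nat.exists_eq_add_of_le hn
    rw [Nat.succ_eq_add_one, zero_add]
    -- A state of reward 2 passes surely to its second copy, so two units are spent before a
    -- transition of `q` is made.
    rw [show 1 + m = aliveReward (some (Sum.inl i : X ⊕ X)) + m from rfl, rewardProb_add,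
      tsum_eq_single (some (.inr i))]
    · have hone : (q.expand b).trans (.inl i) (.inr i) = 1 := by simp [expand, expandMatrix, hb]
      rw [stepPMF_some_some, hone, ENNReal.ofReal_one, one_mul]
      rcases Nat.eq_zero_or_pos m with rfl | hm
      · rw [rewardProb_of_lt _ _ (show 0 < aliveReward (some _) from Nat.zero_lt_one), rewardProb_of_lt _ _ (by rw [hr]; exact Nat.one_lt_two)]
      obtain ⟨m, rfl⟩ := Nat.exists_eq_add_of_le hm
      rw [Nat.succ_eq_add_one, zero_add] at *
      rw [hleave m (by omega) _ (.inl rfl), ← rewardProb_add, hr]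
      congr 1
      simp only [aliveReward, Option.elim]
      omega
    · classical
      rintro (_ | j | j) hj
      · simp [stepPMF_some_none, expand, expandMatrix, hb]
      · simp [stepPMF_some_some, expand, expandMatrix, hb]
      · have : i ≠ j := fun h => hj (by rw [h])
        simp [stepPMF_some_some, expand, expandMatrix, this]
  · have hr : doubleReward b (some i) = 1 := by simp [doubleReward, hb]
    rcases Nat.eq_zero_or_pos n with rfl | hn
    · rw [rewardProb_of_lt _ _ (show 0 < aliveReward (some _) from Nat.zero_lt_one), rewardProb_of_lt _ _ (by rw [hr]; omega)]
    obtain ⟨m, rfl⟩ := Nat.exists_eq_add_of_le hn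
    rw [Nat.succ_eq_add_one, zero_add] at *
    rw [hleave m (by omega) _ (.inr ⟨rfl, hb⟩), ← rewardProb_add, hr]

lemma chainLaw_expand_totalReward_eq (q : SubMarkov X) (b : X → Prop) (n : ℕ) :
    (q.expand b).chainLaw {x | totalReward aliveReward x = n} =
      q.chainLaw {x | totalReward (doubleReward b) x = n} := by
  unfold chainLaw
  rw [markovChainLaw_totalReward_eq, markovChainLaw_totalReward_eq, tsum_fintype, tsum_fintype]
  simp only [Fintype.sum_option, Fintype.sum_sum_type, initPMF_none, initPMF_some,
    rewardProb_expand]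
  simp [expand]

end SubMarkov

/-! ### Point masses of image and product laws -/

/-- A probability mass function carried by the range of an injection `ψ` is the image under `ψ` of
its pullback. -/
lemma PMF.map_eq_of_injective {X Y : Type*} {ψ : X → Y} (hψ : Function.Injective ψ) (q : PMF X)
    (r : PMF Y) (h : ∀ x, r (ψ x) = q x) : q.map ψ = r := by
  have hrange : ∀ x, q.map ψ (ψ x) = q x := by
    intro x
    rw [PMF.map_apply, tsum_eq_single x fun b hb => if_neg (hψ.ne hb.symm), if_pos rfl]
  have hle : ∀ y, q.map ψ y ≤ r y := by
    intro y
    by_cases hy : ∃ x, ψ x = y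
    · obtain ⟨x, rfl⟩ := hy
      rw [hrange, h]
    · push Not at hy
      rw [PMF.map_apply]
      simp [fun x => (hy x).symm]
  refine PMF.ext fun y => le_antisymm (hle y) (le_of_not_gt fun hlt => ?_)
  -- Both families sum to one, so domination cannot be strict at any point.
  have := ENNReal.tsum_lt_tsum (by rw [PMF.tsum_coe]; exact ENNReal.one_ne_top) hle hlt
  rw [PMF.tsum_coe, PMF.tsum_coe] at this
  exact lt_irrefl _ this

lemma PMF.bind_map_mk_apply {A B : Type*} (q : PMF A) (r : PMF B) (a : A) (b : B) :
    (q.bind fun x => r.map fun y => (x, y)) (a, b) = q a * r b := by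
  rw [PMF.bind_apply, tsum_eq_single a]
  · rw [PMF.map_apply, tsum_eq_single b]
    · simp
    · intro y hy
      simp [hy.symm]
  · intro x hx
    rw [PMF.map_apply]
    simp [hx.symm]

open Classical in
lemma PMF.map_diag_apply {A : Type*} (q : PMF A) (a b : A) :
    q.map (fun x => (x, x)) (a, b) = if a = b then q a else 0 := by
  rw [PMF.map_apply]
  split_ifs with h
  · subst h
    rw [tsum_eq_single a]
    · simp
    · intro y hy
      simp [hy.symm]
  · have : ∀ x, (a, b) ≠ (x, x) := fun x hx => by simp_all
    simp [this]

/-! ### Relabelling states, and the phase-type law of a total reward -/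

namespace SubMarkov

variable {X : Type*} [Fintype X]

/-- Transport of a terminating chain along a bijection of the state spaces. -/
def reindex {Y : Type*} [Fintype Y] (q : SubMarkov X) (e : X ≃ Y) : SubMarkov Y where
  init i := q.init (e.symm i)
  trans := Matrix.of fun i j => q.trans (e.symm i) (e.symm j)
  init_nonneg i := q.init_nonneg _
  init_sum := by rw [e.symm.sum_comp q.init, q.init_sum]
  trans_nonneg i j := q.trans_nonneg _ _
  trans_sum i := by
    simp only [Matrix.of_apply]
    rw [e.symm.sum_comp (q.trans (e.symm i))]
    exact q.trans_sum _

lemma chainLaw_reindex {Y : Type*} [Fintype Y] (q : SubMarkov X) (e : X ≃ Y) :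
    (q.reindex e).chainLaw = q.chainLaw.map fun x n => (x n).map e := by
  refine (map_markovChainLaw (Option.map_injective e.injective) _ _ _ _ ?_ ?_).symm
  · refine PMF.map_eq_of_injective (Option.map_injective e.injective) _ _ ?_
    rintro (_ | x)
    · exact (initPMF_none _).trans (initPMF_none _).symm
    · simp [initPMF_some, reindex]
  · intro x
    refine PMF.map_eq_of_injective (Option.map_injective e.injective) _ _ ?_
    rcases x with _ | x
    · rintro (_ | y) <;> simp [stepPMF]
    · rintro (_ | y)
      · simp only [Option.map_some, Option.map_none, stepPMF_some_none, reindex, Matrix.of_apply]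
        rw [e.symm.sum_comp (q.trans (e.symm (e x))), e.symm_apply_apply]
      · simp [stepPMF_some_some, reindex]

lemma terminationTime_map {X Y : Type*} (f : X → Y) (x : ℕ → Option X) :
    terminationTime (fun n => (x n).map f) = terminationTime x := by
  simp [terminationTime]

lemma measurable_map_path {X Y : Type*} (f : X → Y) :
    Measurable fun (x : ℕ → Option X) n => (x n).map f :=
  measurable_pi_lambda _ fun n => Measurable.comp (g := Option.map f)
    (fun _ _ => MeasurableSpace.measurableSet_top) (measurable_pi_apply n)

lemma IsTerminating.reindex {Y : Type*} [Fintype Y] {q : SubMarkov X} (h : q.IsTerminating)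
    (e : X ≃ Y) : (q.reindex e).IsTerminating := by
  unfold IsTerminating
  rw [chainLaw_reindex]
  refine (ae_map_iff (measurable_map_path e).aemeasurable ?_).2 ?_
  · have : {x : ℕ → Option Y | ∃ n, 0 < n ∧ x n = none} =
        ⋃ n : ℕ, ⋃ _ : 0 < n, (fun x => x n) ⁻¹' {none} := by
      ext
      simp
    rw [this]
    exact MeasurableSet.iUnion fun n => MeasurableSet.iUnion fun _ =>
      measurable_pi_apply n (measurableSet_singleton _)
  · filter_upwards [h] with x hx
    simpa using hx

lemma dphLaw_reindex {Y : Type*} [Fintype Y] (q : SubMarkov X) (e : X ≃ Y) :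
    (q.reindex e).dphLaw = q.dphLaw := by
  unfold dphLaw
  rw [chainLaw_reindex, Measure.map_map measurable_terminationTime (measurable_map_path e)]
  congr 1
  exact funext (terminationTime_map e)

/-- A random variable distributed as the termination time of a terminating chain with an arbitrary
finite state space has a discrete phase-type distribution. -/
lemma IsTerminating.followsDPH {Ω : Type*} [MeasurableSpace Ω] {μ : Measure Ω} {q : SubMarkov X}
    (h : q.IsTerminating) {Y : Ω → ℕ} (hY : HasLaw Y q.dphLaw μ) : FollowsDPH Y μ :=
  ⟨_, q.reindex (Fintype.equivFin X), h.reindex _, by rwa [dphLaw_reindex]⟩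

lemma measurableSet_totalReward_eq {X : Type*} [Countable X] (ρ : Option X → ℕ) (n : ℕ) :
    MeasurableSet {x | totalReward ρ x = n} :=
  measurable_totalReward ρ (measurableSet_singleton (n : ENNReal))

/-- The total reward of a chain with rewards in `{1, 2}`, when it is almost surely finite, has a
discrete phase-type distribution. -/
lemma followsDPH_of_totalReward {Ω : Type*} [MeasurableSpace Ω] {μ : Measure Ω} (q : SubMarkov X)
    (b : X → Prop) {T : (ℕ → Option X) → ℕ}
    (hT : ∀ᵐ x ∂q.chainLaw, totalReward (doubleReward b) x = T x) {Y : Ω → ℕ}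
    (hY : HasLaw Y (q.chainLaw.map T) μ) (hTm : AEMeasurable T q.chainLaw) :
    FollowsDPH Y μ := by
  have hprob : IsProbabilityMeasure q.chainLaw := isProbabilityMeasure_markovChainLaw _ _
  have hprob' : IsProbabilityMeasure (q.expand b).chainLaw :=
    isProbabilityMeasure_markovChainLaw _ _
  have hdisj : ∀ (Z : Type _) (ρ : Option Z → ℕ),
      Pairwise (Function.onFun Disjoint fun n : ℕ => {x | totalReward ρ x = n}) := by
    intro Z ρ m n hmn
    refine Set.disjoint_left.2 fun x (hx : _ = _) (hx' : _ = _) => hmn ?_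
    exact_mod_cast hx.symm.trans hx'
  -- The events of total reward `n` have equal probabilities under the two chains and are disjoint,
  -- so their union has full measure for one chain because it has for the other.
  have hfin : ∀ᵐ x ∂(q.expand b).chainLaw, ∃ n : ℕ, totalReward aliveReward x = n := by
    have hu : {x | ∃ n : ℕ, totalReward (aliveReward : Option (X ⊕ X) → ℕ) x = n} =
        ⋃ n : ℕ, {x | totalReward aliveReward x = n} := by
      ext
      simp
    have hu' : (⋃ n : ℕ, {x | totalReward (doubleReward b) x = n}) ∈ ae q.chainLaw := by
      filter_upwards [hT] with x hx
      exact Set.mem_iUnion.2 ⟨_, hx⟩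
    change {x | ∃ n : ℕ, totalReward (aliveReward : Option (X ⊕ X) → ℕ) x = n} ∈ ae _
    rw [hu, mem_ae_iff_prob_eq_one
      (MeasurableSet.iUnion fun n => measurableSet_totalReward_eq _ n),
      measure_iUnion (hdisj _ _) fun n => measurableSet_totalReward_eq _ n]
    simp only [chainLaw_expand_totalReward_eq]
    rw [← measure_iUnion (hdisj _ _) fun n => measurableSet_totalReward_eq _ n]
    exact (mem_ae_iff_prob_eq_one
      (MeasurableSet.iUnion fun n => measurableSet_totalReward_eq _ n)).1 hu'
  have hterm : (q.expand b).IsTerminating := by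
    unfold IsTerminating
    filter_upwards [hfin, (q.expand b).chainLaw_ae] with x ⟨n, hn⟩ hx
    exact exists_eq_none_of_totalReward_ne_top hx.1 (hn ▸ ENNReal.natCast_ne_top n)
  refine hterm.followsDPH ?_
  convert hY using 1
  refine Measure.ext_of_singleton fun n => ?_
  rw [dphLaw, Measure.map_apply measurable_terminationTime (measurableSet_singleton n),
    Measure.map_apply_of_aemeasurable hTm (measurableSet_singleton n)]
  calc _ = (q.expand b).chainLaw {x | totalReward aliveReward x = n} := by
        refine measure_congr ?_
        filter_upwards [hterm, (q.expand b).chainLaw_ae] with x hx hx'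
        refine propext ?_
        change terminationTime x = n ↔ totalReward aliveReward x = n
        rw [totalReward_aliveReward hx'.1 hx'.2 hx, Nat.cast_inj]
    _ = q.chainLaw {x | totalReward (doubleReward b) x = n} :=
        chainLaw_expand_totalReward_eq q b n
    _ = _ := by
        refine measure_congr ?_
        filter_upwards [hT] with x hx
        refine propext ?_
        change totalReward (doubleReward b) x = n ↔ T x = n
        rw [hx, Nat.cast_inj]

end SubMarkov

/-! ### The pair process as an image of `γ` -/

namespace CDPHParam

/-- The states of the two coordinates that correspond to a state of `γ`. -/
def gammaPair {E S : Type*} :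
    Option (GammaState E S) → Option (E ⊕ S) × Option (E ⊕ S)
  | some (.inl i) => (some (.inl i), some (.inl i))
  | some (.inr (.inl (i, j))) => (some (.inr i), some (.inr j))
  | some (.inr (.inr (.inl j))) => (none, some (.inr j))
  | some (.inr (.inr (.inr i))) => (some (.inr i), none)
  | none => (none, none)

lemma gammaPair_injective {E S : Type*} : Function.Injective (gammaPair (E := E) (S := S)) := by
  rintro (_ | i | ⟨i₁, i₂⟩ | i | i) (_ | j | ⟨j₁, j₂⟩ | j | j) h <;>
    simp_all [gammaPair]

lemma measurable_gammaPair_path {E S : Type*} :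
    Measurable fun (x : ℕ → Option (GammaState E S)) n => gammaPair (x n) :=
  measurable_pi_lambda _ fun n => Measurable.comp (g := gammaPair)
    (fun _ _ => MeasurableSpace.measurableSet_top) (measurable_pi_apply n)

lemma measurable_terminationTime_coordinates {E S : Type*} :
    Measurable fun x : ℕ → Option (E ⊕ S) × Option (E ⊕ S) =>
      (terminationTime fun n => (x n).1, terminationTime fun n => (x n).2) :=
  (measurable_terminationTime.comp
    (measurable_pi_lambda _ fun n => measurable_fst.comp (measurable_pi_apply n))).prodMk
  (measurable_terminationTime.comp
    (measurable_pi_lambda _ fun n => measurable_snd.comp (measurable_pi_apply n)))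

lemma gammaPair_eq_none {E S : Type*} {x : Option (GammaState E S)} (h₁ : (gammaPair x).1 = none)
    (h₂ : (gammaPair x).2 = none) : x = none := by
  rcases x with _ | i | ⟨i₁, i₂⟩ | i | i <;> simp_all [gammaPair]

lemma aggregationReward_eq_add {E S : Type*} (x : Option (GammaState E S)) :
    aggregationReward x = aliveReward (gammaPair x).1 + aliveReward (gammaPair x).2 := by
  rcases x with _ | i | ⟨i₁, i₂⟩ | i | i <;> rfl

lemma aggregationReward_eq_doubleReward {E S : Type*} (x : Option (GammaState E S)) :
    aggregationReward x = SubMarkov.doubleReward (fun i => aggregationReward (some i) = 2) x := by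
  rcases x with _ | i | ⟨i₁, i₂⟩ | i | i <;>
    simp [SubMarkov.doubleReward, aggregationReward]

variable {E S : Type*} [Fintype E] [Fintype S] [DecidableEq S]

lemma map_gamma_initPMF (p : CDPHParam E S) : p.gamma.initPMF.map gammaPair = p.pairInit := by
  refine PMF.map_eq_of_injective gammaPair_injective _ _ ?_
  rintro (_ | i | ⟨i₁, i₂⟩ | i | i) <;>
    simp only [gammaPair, pairInit, PMF.map_diag_apply, SubMarkov.initPMF_none,
      SubMarkov.initPMF_some] <;>
    simp [gamma, marginal₁, marginal]

section marginal

variable {E S : Type*} [Fintype E] [Fintype S] (p : CDPHParam E S) {Q : Matrix S S ℝ}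
  (hQ : ∀ i j, 0 ≤ Q i j) (hQ' : ∀ i, ∑ j, Q i j ≤ 1)

lemma marginal_stepPMF_inl_none (i : E) :
    (p.marginal Q hQ hQ').stepPMF (some (.inl i)) none = 0 := by
  rw [SubMarkov.stepPMF_some_none, marginal]
  simp [p.PU_sum i]

lemma marginal_stepPMF_inl_inl (i j : E) :
    (p.marginal Q hQ hQ').stepPMF (some (.inl i)) (some (.inl j)) = ENNReal.ofReal (p.P i j) := rfl

lemma marginal_stepPMF_inl_inr (i : E) (j : S) :
    (p.marginal Q hQ hQ').stepPMF (some (.inl i)) (some (.inr j)) = ENNReal.ofReal (p.U i j) := rfl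

lemma marginal_stepPMF_inr_none (i : S) :
    (p.marginal Q hQ hQ').stepPMF (some (.inr i)) none = ENNReal.ofReal (exit Q i) := by
  rw [SubMarkov.stepPMF_some_none, marginal]
  simp [exit]

lemma marginal_stepPMF_inr_inl (i : S) (j : E) :
    (p.marginal Q hQ hQ').stepPMF (some (.inr i)) (some (.inl j)) = 0 := ENNReal.ofReal_zero

lemma marginal_stepPMF_inr_inr (i j : S) :
    (p.marginal Q hQ hQ').stepPMF (some (.inr i)) (some (.inr j)) = ENNReal.ofReal (Q i j) := rfl

end marginal

/-- Away from `E`, the two coordinates move independently. -/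
lemma pairStep_apply_of_ne {E S : Type*} [Fintype E] [Fintype S] (p : CDPHParam E S)
    {x : Option (E ⊕ S)} (hx : ∀ i, x ≠ some (.inl i)) (y x' y' : Option (E ⊕ S)) :
    p.pairStep (x, y) (x', y') = p.marginal₁.stepPMF x x' * p.marginal₂.stepPMF y y' := by
  rw [← PMF.bind_map_mk_apply]
  rcases x with _ | i | i
  · rfl
  · exact absurd rfl (hx i)
  · rfl

/-- With row sums `a` and `b`, the missing mass is `1 - ab - (1 - a)b - a(1 - b) = (1 - a)(1 - b)`:
both coordinates terminate simultaneously and independently. -/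
lemma sum_gammaMatrix_pair (p : CDPHParam E S) (i₁ i₂ : S) :
    1 - ∑ j, p.gammaMatrix (.inr (.inl (i₁, i₂))) j = exit p.Q₁ i₁ * exit p.Q₂ i₂ := by
  simp only [gammaMatrix, exit, Fintype.sum_sum_type, Fintype.sum_prod_type,
    ← Finset.mul_sum, ← Finset.sum_mul, Finset.sum_const_zero]
  ring

/-- By injectivity of `gammaPair` it suffices to match masses on its range. Each block of
`gammaMatrix` is a diagonal move, or a product of moves of the two coordinates in which a dead one
stays put. -/
lemma map_gamma_stepPMF (p : CDPHParam E S) (x : Option (GammaState E S)) :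
    (p.gamma.stepPMF x).map gammaPair = p.pairStep (gammaPair x) := by
  have h₁ : ∀ i, 0 ≤ exit p.Q₁ i := fun i => sub_nonneg.2 (p.Q₁_sum i)
  refine PMF.map_eq_of_injective gammaPair_injective _ _ ?_
  rcases x with _ | i | ⟨i₁, i₂⟩ | i | i
  · rintro (_ | j | ⟨j₁, j₂⟩ | j | j) <;>
      simp [gammaPair, pairStep_apply_of_ne, SubMarkov.stepPMF]
  · rintro (_ | j | ⟨j₁, j₂⟩ | j | j)
    all_goals
      simp only [gammaPair, pairStep, PMF.map_diag_apply, marginal₁, marginal_stepPMF_inl_none,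
        marginal_stepPMF_inl_inl, marginal_stepPMF_inl_inr]
      simp [SubMarkov.stepPMF_some_none, SubMarkov.stepPMF_some_some, gamma, gammaMatrix, p.PU_sum i, Fintype.sum_prod_type]
    split_ifs
    exacts [rfl, ENNReal.ofReal_zero.symm]
  · rintro (_ | j | ⟨j₁, j₂⟩ | j | j)
    all_goals
      rw [gammaPair, gammaPair, pairStep_apply_of_ne p (by simp)]
      simp only [marginal₁, marginal₂, marginal_stepPMF_inr_none, marginal_stepPMF_inr_inl,
        marginal_stepPMF_inr_inr]
      simp only [SubMarkov.stepPMF_some_none, SubMarkov.stepPMF_some_some, gamma,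
        sum_gammaMatrix_pair]
      simp [gammaMatrix, ENNReal.ofReal_mul, p.Q₁_nonneg, h₁]
  · rintro (_ | j | ⟨j₁, j₂⟩ | j | j)
    all_goals
      rw [gammaPair, gammaPair, pairStep_apply_of_ne p (by simp)]
      simp only [marginal₂, marginal_stepPMF_inr_none, marginal_stepPMF_inr_inl,
        marginal_stepPMF_inr_inr]
      simp [SubMarkov.stepPMF_some_none, SubMarkov.stepPMF_some_some, SubMarkov.stepPMF_none, gamma,
        gammaMatrix, exit]
  · rintro (_ | j | ⟨j₁, j₂⟩ | j | j)
    all_goals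
      rw [gammaPair, gammaPair, pairStep_apply_of_ne p (by simp)]
      simp only [marginal₁, marginal_stepPMF_inr_none, marginal_stepPMF_inr_inl,
        marginal_stepPMF_inr_inr]
      simp [SubMarkov.stepPMF_some_none, SubMarkov.stepPMF_some_some, SubMarkov.stepPMF_none, gamma,
        gammaMatrix, exit]

lemma pairLaw_eq_map (p : CDPHParam E S) :
    p.pairLaw = p.gamma.chainLaw.map fun x n => gammaPair (x n) :=
  (map_markovChainLaw gammaPair_injective _ _ _ _ p.map_gamma_initPMF p.map_gamma_stepPMF).symm

/-- Both coordinates of the joint process start alive and are absorbed in the cemetery. -/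
lemma gamma_ae_coordinates (p : CDPHParam E S) :
    ∀ᵐ x ∂p.gamma.chainLaw,
      ((gammaPair (x 0)).1 ≠ none ∧
        ∀ n, (gammaPair (x n)).1 = none → (gammaPair (x (n + 1))).1 = none) ∧
      ((gammaPair (x 0)).2 ≠ none ∧
        ∀ n, (gammaPair (x n)).2 = none → (gammaPair (x (n + 1))).2 = none) := by
  have hstep : ∀ x y, p.gamma.stepPMF x y ≠ 0 →
      ((gammaPair x).1 = none → (gammaPair y).1 = none) ∧
      ((gammaPair x).2 = none → (gammaPair y).2 = none) := by
    rintro (_ | i | ⟨i₁, i₂⟩ | i | i) (_ | j | ⟨j₁, j₂⟩ | j | j) h <;>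
      simp_all [gammaPair, SubMarkov.stepPMF_some_some, SubMarkov.stepPMF_none, gamma,
        gammaMatrix]
  have hinit : ∀ x, p.gamma.initPMF x ≠ 0 →
      (gammaPair x).1 ≠ none ∧ (gammaPair x).2 ≠ none := by
    rintro (_ | i | ⟨i₁, i₂⟩ | i | i) h <;>
      simp_all [gammaPair, SubMarkov.initPMF_some, SubMarkov.initPMF_none, gamma]
  filter_upwards [markovChainLaw_ae_step p.gamma.initPMF p.gamma.stepPMF] with x hx
  exact ⟨⟨(hinit _ hx.1).1, fun n => (hstep _ _ (hx.2 n)).1⟩,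
    ⟨(hinit _ hx.1).2, fun n => (hstep _ _ (hx.2 n)).2⟩⟩

lemma gamma_ae_of_isTerminating {p : CDPHParam E S} (h : p.IsTerminating) :
    ∀ᵐ x ∂p.gamma.chainLaw, (∃ n, 0 < n ∧ (gammaPair (x n)).1 = none) ∧
      ∃ n, 0 < n ∧ (gammaPair (x n)).2 = none := by
  unfold IsTerminating at h
  rw [pairLaw_eq_map] at h
  exact ae_of_ae_map measurable_gammaPair_path.aemeasurable h

lemma gamma_isTerminating {p : CDPHParam E S} (h : p.IsTerminating) : p.gamma.IsTerminating := by
  unfold SubMarkov.IsTerminating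
  filter_upwards [gamma_ae_of_isTerminating h, p.gamma_ae_coordinates] with x hx hx'
  obtain ⟨⟨m, hm, hm'⟩, ⟨n, -, hn'⟩⟩ := hx
  -- By absorption both coordinates are dead at the later of the two times.
  exact ⟨max m n, lt_max_of_lt_left hm, gammaPair_eq_none
    (eq_none_of_le (x := fun k => (gammaPair (x k)).1) hx'.1.2 hm' (le_max_left m n))
    (eq_none_of_le (x := fun k => (gammaPair (x k)).2) hx'.2.2 hn' (le_max_right m n))⟩

/-- The reward is the number of live coordinates, and series in `ENNReal` add termwise without any
summability condition. -/
lemma totalReward_aggregationReward_ae {p : CDPHParam E S} (h : p.IsTerminating) :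
    ∀ᵐ x ∂p.gamma.chainLaw, totalReward aggregationReward x =
      ((terminationTime fun n => (gammaPair (x n)).1) +
        (terminationTime fun n => (gammaPair (x n)).2) : ℕ) := by
  filter_upwards [gamma_ae_of_isTerminating h, p.gamma_ae_coordinates] with x hx hx'
  rw [Nat.cast_add, ← totalReward_aliveReward hx'.1.1 hx'.1.2 hx.1,
    ← totalReward_aliveReward hx'.2.1 hx'.2.2 hx.2]
  simp only [totalReward, aggregationReward_eq_add, Nat.cast_add]
  exact ENNReal.tsum_add

lemma accumulatedReward_ae {p : CDPHParam E S} (h : p.IsTerminating) :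
    ∀ᵐ x ∂p.gamma.chainLaw, accumulatedReward x =
      (terminationTime fun n => (gammaPair (x n)).1) +
        terminationTime fun n => (gammaPair (x n)).2 := by
  filter_upwards [totalReward_aggregationReward_ae h, gamma_isTerminating h,
    p.gamma.chainLaw_ae] with x hx hx' hx''
  rw [totalReward_eq_sum hx''.2 hx' rfl] at hx
  exact_mod_cast hx

end CDPHParam

theorem mainTheorem6 {E S Ω : Type*} [Fintype E] [Fintype S] [DecidableEq S]
    [MeasurableSpace Ω] (μ : Measure Ω) [IsProbabilityMeasure μ]
    (p : CDPHParam E S) (τ₁ τ₂ : Ω → ℕ) (h : FollowsCDPH p τ₁ τ₂ μ) :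
    FollowsDPH (fun ω => τ₁ ω + τ₂ ω) μ ∧
      p.gamma.IsTerminating ∧
      HasLaw (fun ω => τ₁ ω + τ₂ ω) (p.gamma.chainLaw.map accumulatedReward) μ := by
  obtain ⟨hterm, hlaw⟩ := h
  have hpair := CDPHParam.measurable_terminationTime_coordinates (E := E) (S := S)
  have hadd : Measurable fun z : ℕ × ℕ => z.1 + z.2 := measurable_fst.add measurable_snd
  have hmeas : Measurable fun x : ℕ → Option (GammaState E S) =>
      (terminationTime fun n => (CDPHParam.gammaPair (x n)).1) +
        terminationTime fun n => (CDPHParam.gammaPair (x n)).2 :=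
    hadd.comp (hpair.comp CDPHParam.measurable_gammaPair_path)
  have hsum : HasLaw (fun ω => τ₁ ω + τ₂ ω) (p.gamma.chainLaw.map accumulatedReward) μ := by
    refine ⟨hadd.comp_aemeasurable hlaw.aemeasurable, ?_⟩
    -- The accumulated reward is exchanged for an almost surely equal function of the coordinates,
    -- whose measurability is known.
    rw [Measure.map_congr (CDPHParam.accumulatedReward_ae hterm)]
    calc μ.map (fun ω => τ₁ ω + τ₂ ω)
        = (μ.map fun ω => (τ₁ ω, τ₂ ω)).map fun z => z.1 + z.2 :=
          (AEMeasurable.map_map_of_aemeasurable hadd.aemeasurable hlaw.aemeasurable).symm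
      _ = _ := by
          rw [hlaw.map_eq, CDPHParam.cdphLaw, CDPHParam.pairLaw_eq_map,
            Measure.map_map hpair CDPHParam.measurable_gammaPair_path,
            Measure.map_map hadd (hpair.comp CDPHParam.measurable_gammaPair_path)]
          rfl
  refine ⟨?_, CDPHParam.gamma_isTerminating hterm, hsum⟩
  refine p.gamma.followsDPH_of_totalReward (fun i => aggregationReward (some i) = 2) ?_ hsum
    -- Almost-everywhere measurability of `accumulatedReward` is inherited from the same function.
    (hmeas.aemeasurable.congr (Filter.EventuallyEq.symm (CDPHParam.accumulatedReward_ae hterm)))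
  filter_upwards [CDPHParam.totalReward_aggregationReward_ae hterm,
    CDPHParam.accumulatedReward_ae hterm] with x hx hx'
  rw [hx', ← hx]
  exact tsum_congr fun l => by rw [CDPHParam.aggregationReward_eq_doubleReward (x l)]
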